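/- **Theorem 1.** There are absolute constants $c_1,c_2>0$ such that the following holds. Let $K\ge 1$, $m\ge 1$, $\delta\in(0,1)$, and let $(\mathcal X_i,y_i)$, $i=1,\dots,m$, be i.i.d. with law $\mu$ on $\mathbb R^{n_1\times\cdots\times n_K}\times\mathcal Y$, where under $\mu$ the covariate $\mathcal X$ has i.i.d. standard Gaussian entries (the target $y$ may depend on $\mathcal X$ arbitrarily). Let $\ell:\mathbb R\times\mathcal Y\to\mathbb R$ be $\Lambda$-Lipschitz in its first argument, with $\mathbb E|\ell(0,y)|<\infty$. Put $$R(\mathcal W)=\mathbb E_{(\mathcal X,y)\sim\mu}\,\ell(\langle\mathcal W,\mathcal X\rangle,y),\qquad \hat R(\mathcal W)=\frac1m\sum_{i=1}^m\ell(\langle\mathcal W,\mathcal X_i\rangle,y_i),$$ and let $\|\mathcal W\|_{\mathrm{overlap}}=\sum_{k=1}^K\|W_{(k)}\|_{\mathrm{tr}}$, where $W_{(k)}$ is the mode-$k$ unfolding and $\|\cdot\|_{\mathrm{tr}}$ the sum of the singular values. Let $\mathcal W^0$ minimize $R$ subject to $\|\mathcal W\|_{\mathrm{overlap}}\le B_0$,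 and let $\hat{\mathcal W}$ be any minimizer of $\hat R$ subject to the same constraint. Suppose that $\|\mathcal W^0\|_F\le B$, that $\mathcal W^0$ has multilinear ranks $(r_1,\dots,r_K)$, $r_k=\operatorname{rank}W^0_{(k)}$, and that $B_0\le B\sum_{k=1}^K\sqrt{r_k}$. Write $n_{\setminus k}=\prod_{j\ne k}n_j$. Then: (i) if $\ell$ takes values in $[0,M]$, then with probability at least $1-\delta$ $$R(\hat{\mathcal W})-R(\mathcal W^0)\le c_1\Lambda\frac{B}{\sqrt m}\Big(\sum_{k=1}^K\sqrt{r_k}\Big)\min_k\big(\sqrt{n_k}+\sqrt{n_{\setminus k}}\big)+c_2M\sqrt{\frac{\log(2/\delta)}{2m}};$$ (ii) for every $\ell$ as above, bounded or not, with probability at least $1-\delta$ $$R(\hat{\mathcal W})-R(\mathcal W^0)\le c_1\Lambda\frac{B}{\sqrt m}\Big(\sum_{k=1}^K\sqrt{r_k}\Big)\min_k\big(\sqrt{n_k}+\sqrt{n_{\setminus k}}\big)+c_2\Lambda B_0\sqrt{\frac{\log(2/\delta)}{2m}}.$$ -/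

import Mathlib

open MeasureTheory ProbabilityTheory

noncomputable section

/-- Real `K`-way tensors of size `n 0 × ⋯ × n (K - 1)`. -/
abbrev Tensor {K : ℕ} (n : Fin K → ℕ) : Type := ((k : Fin K) → Fin (n k)) → ℝ

variable {K : ℕ} {n : Fin K → ℕ}

/-- The inner product of two tensors: the sum of the entrywise products. -/
def tensorInner (W X : Tensor n) : ℝ := ∑ i, W i * X i

/-- The Frobenius norm of a tensor. -/
def frobeniusNorm (W : Tensor n) : ℝ := √(tensorInner W W)

/-- The mode-`k` unfolding: the matrix whose columns are the mode-`k` fibers. Rows are indexed by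
the `k`-th index, columns by the tuple of all the other indices. -/
def unfold (W : Tensor n) (k : Fin K) :
    Matrix (Fin (n k)) ((j : {j : Fin K // j ≠ k}) → Fin (n j)) ℝ :=
  Matrix.of fun a c => W ((Equiv.piSplitAt k fun j => Fin (n j)).symm (a, c))

/-- The trace norm of a real matrix: the sum of its singular values. -/
def traceNorm {ι κ : Type} [Fintype ι] [Fintype κ] [DecidableEq κ] (A : Matrix ι κ ℝ) : ℝ :=
  (Matrix.toEuclideanLin A).singularValues.sum fun _ s => s

/-- The overlapped trace norm: the sum over all modes of the trace norms of the unfoldings. -/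
def overlapNorm (W : Tensor n) : ℝ := ∑ k, traceNorm (unfold W k)

/-- The mode-`k` rank; the multilinear rank is the tuple of all of them. -/
def modeRank (W : Tensor n) (k : Fin K) : ℕ := (unfold W k).rank

/-- `n_{∖k}`, the product of all the dimensions except the `k`-th one. -/
def coDim (n : Fin K → ℕ) (k : Fin K) : ℕ := ∏ j ∈ Finset.univ.erase k, n j

/-- The law of a tensor with independent standard Gaussian entries. -/
def stdGaussianTensor (n : Fin K → ℕ) : Measure (Tensor n) :=
  Measure.pi fun _ => gaussianReal 0 1

/-- The expected risk of the coefficient tensor `W`, for the loss `ℓ` and the law `μ` of a pair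
(covariate tensor, target). -/
def risk {𝒴 : Type*} [MeasurableSpace 𝒴] (ℓ : ℝ → 𝒴 → ℝ) (μ : Measure (Tensor n × 𝒴))
    (W : Tensor n) : ℝ :=
  ∫ z, ℓ (tensorInner W z.1) z.2 ∂μ

/-- The empirical risk of the coefficient tensor `W` on the sample `S` of size `m`. -/
def empiricalRisk {𝒴 : Type*} (ℓ : ℝ → 𝒴 → ℝ) {m : ℕ} (S : Fin m → Tensor n × 𝒴)
    (W : Tensor n) : ℝ :=
  1 / (m : ℝ) * ∑ i, ℓ (tensorInner W (S i).1) (S i).2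

/-- `W` minimizes `F` subject to the constraint that the overlapped trace norm is at most `B₀`. -/
def IsConstrainedMinimizer (F : Tensor n → ℝ) (B₀ : ℝ) (W : Tensor n) : Prop :=
  overlapNorm W ≤ B₀ ∧ ∀ V : Tensor n, overlapNorm V ≤ B₀ → F W ≤ F V

/-- With probability at least `1 - δ` over an i.i.d. sample of size `m` drawn from `μ`, every
empirical risk minimizer over the overlapped-trace-norm ball of radius `B₀` has excess risk at most
`ε` relative to `W₀`. The failure event is not presupposed to be measurable: `Measure` of a set is
its outer measure. -/
def ExcessRiskAtMost {𝒴 : Type*} [MeasurableSpace 𝒴] (ℓ : ℝ → 𝒴 → ℝ)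
    (μ : Measure (Tensor n × 𝒴)) (m : ℕ) (B₀ : ℝ) (W₀ : Tensor n) (ε δ : ℝ) : Prop :=
  (Measure.pi fun _ : Fin m => μ)
    {S | ∃ What : Tensor n, IsConstrainedMinimizer (empiricalRisk ℓ S) B₀ What ∧
      ε < risk ℓ μ What - risk ℓ μ W₀} ≤ ENNReal.ofReal δ

end

/-!
The excess risk of an empirical minimizer is at most the supremum, over the ball of the overlapped
trace norm, of the gap between the expected and the empirical excess risk relative to `W₀`. Since
this gap is continuous in the competitor, finite families of competitors suffice
(`excessRiskAtMost_of_finite_families`), and no uncountable supremum has to be measured.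

For a finite family the whole moment generating function of the supremum is bounded, not only its
mean. Symmetrization and contraction are carried out one observation at a time
(`lintegral_exp_iSup_sum_centered_le`): conditionally on the other observations, Jensen's inequality
introduces an independent copy, `exp (p + q) ≤ (exp (2 p) + exp (2 q)) / 2` separates the copies,
and the two-point contraction principle `exp_iSup_add_exp_iSup_le` replaces the loss increments by
`Λ ⟨W - W₀, X⟩`; the symmetry of the Gaussian law plays the role of the random signs. By trace
duality, `⟨W, G⟩` is at most the trace norm of any unfolding `W₍ₖ₎` times the operator norm of
`G₍ₖ₎`, and the latter is at most the maximum of `⟨d cᵀ, G₍ₖ₎⟩` over at most `5 ^ (n k + n∖k)`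
pairs `(c, d)` of net points. A union bound gives (`lintegral_exp_iSup_excessRiskGap_le`)
`E exp (l Z) ≤ exp (D + V l² / 2)` with `D = 2 (n k + n∖k)` and `V = 256 (Λ B₀)² / m`.

Chernoff's bound with `√(2 V (D + L)) ≤ √(2 V D) + √(2 V L)` is the bound for unbounded losses:
`√(2 V D)` is the leading term. For losses in `[0, M]` the same estimate gives
`E Z ≤ √(2 V D)`, and McDiarmid's inequality controls `Z - E Z`.
-/

noncomputable section

variable {K : ℕ} {n : Fin K → ℕ}

/-! ### Contraction -/

/-- The two-point form of the contraction principle: among two competitors `(a, s)` and `(a', s')`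
that maximize `a + s` and `a - s` respectively, replacing the values `s`, `s'` by values `t`, `t'`
that dominate them in size and in distance does not decrease the sum of exponentials, possibly
after exchanging the roles of the competitors. -/
lemma exp_add_exp_le_of_contraction {a a' s s' t t' : ℝ} (hs : |s| ≤ |t|) (hs' : |s'| ≤ |t'|)
    (hss : |s - s'| ≤ |t - t'|) (h : a' + s' ≤ a + s) (h' : a - s ≤ a' - s') :
    Real.exp (a + s) + Real.exp (a' - s') ≤
      max (Real.exp (a + t) + Real.exp (a' - t')) (Real.exp (a' + t') + Real.exp (a - t)) := by
  -- The statement is invariant under `(t, t') ↦ (-t, -t')`, which swaps the two sides of the `max`.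
  wlog ht : 0 ≤ t generalizing t t'
  · have := this (t := -t) (t' := -t') (by rwa [abs_neg]) (by rwa [abs_neg])
      (by rwa [show -t - -t' = -(t - t') by ring, abs_neg]) (by linarith)
    rw [max_comm] at this
    convert! this using 2 <;> ring_nf
  have increment : ∀ x y d d' : ℝ, x ≤ y → 0 ≤ d' → d' ≤ d →
      Real.exp (x + d') - Real.exp x ≤ Real.exp (y + d) - Real.exp y := by
    intro x y d d' hxy hd' hdd
    have h1 : Real.exp x ≤ Real.exp y := Real.exp_le_exp.2 hxy
    have h2 : Real.exp d' ≤ Real.exp d := Real.exp_le_exp.2 hdd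
    have h3 : 1 ≤ Real.exp d' := Real.one_le_exp hd'
    have h4 := Real.exp_pos x
    rw [Real.exp_add, Real.exp_add]
    nlinarith [mul_nonneg (sub_nonneg.2 h1) (sub_nonneg.2 h3),
      mul_nonneg (h4.le.trans h1) (sub_nonneg.2 h2)]
  have hs1 := abs_le.1 hs
  have hs1' := abs_le.1 hs'
  have hss1 := abs_le.1 hss
  rw [abs_of_nonneg ht] at hs1
  rcases le_total 0 t' with ht' | ht'
  · rw [abs_of_nonneg ht'] at hs1'
    rcases le_total t' t with htt | htt
    · rw [abs_of_nonneg (sub_nonneg.2 htt)] at hss1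
      refine le_max_of_le_left ?_
      have := increment (a' - t') (a + s) (t - s) (t' - s') (by linarith) (by linarith)
        (by linarith)
      rw [show a' - t' + (t' - s') = a' - s' by ring, show a + s + (t - s) = a + t by ring] at this
      linarith
    · rw [abs_of_nonpos (sub_nonpos.2 htt)] at hss1
      refine le_max_of_le_right ?_
      have := increment (a - t) (a' - s') (t' + s') (t + s) (by linarith) (by linarith)
        (by linarith)
      rw [show a - t + (t + s) = a + s by ring,
        show a' - s' + (t' + s') = a' + t' by ring] at this
      linarith
  · rw [abs_of_nonpos ht'] at hs1'
    exact le_max_of_le_left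
      (add_le_add (Real.exp_le_exp.2 (by linarith)) (Real.exp_le_exp.2 (by linarith)))

/-- The contraction principle for one random sign and the exponential function: averaging
`exp (⨆ i, (a i ± s i))` over the sign, the values `s` may be replaced by values `t` that dominate
them in size and in mutual distance. -/
lemma exp_iSup_add_exp_iSup_le {ι : Type*} [Finite ι] [Nonempty ι] (a s t : ι → ℝ)
    (hst : ∀ i, |s i| ≤ |t i|) (hd : ∀ i j, |s i - s j| ≤ |t i - t j|) :
    Real.exp (⨆ i, (a i + s i)) + Real.exp (⨆ i, (a i - s i)) ≤
      Real.exp (⨆ i, (a i + t i)) + Real.exp (⨆ i, (a i - t i)) := by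
  have le_sup : ∀ (f : ι → ℝ) (i : ι), f i ≤ ⨆ i, f i :=
    fun f i => le_ciSup (Finite.bddAbove_range f) i
  obtain ⟨i, hi⟩ := exists_eq_ciSup_of_finite (f := fun i => a i + s i)
  obtain ⟨j, hj⟩ := exists_eq_ciSup_of_finite (f := fun i => a i - s i)
  have hij := le_sup (fun i => a i + s i) j
  have hji := le_sup (fun i => a i - s i) i
  rw [← hi] at hij ⊢
  rw [← hj] at hji ⊢
  refine (exp_add_exp_le_of_contraction (hst i) (hst j) (hd i j) hij hji).trans (max_le ?_ ?_)
  · exact add_le_add (Real.exp_le_exp.2 (le_sup (fun i => a i + t i) i))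
      (Real.exp_le_exp.2 (le_sup (fun i => a i - t i) j))
  · exact add_le_add (Real.exp_le_exp.2 (le_sup (fun i => a i + t i) j))
      (Real.exp_le_exp.2 (le_sup (fun i => a i - t i) i))

/-! ### Symmetrization -/

/-- Jensen's inequality for the exponential function; no integrability of `exp ∘ g` is needed when
its expectation is a Lebesgue integral. -/
lemma ofReal_exp_integral_le_lintegral {Ω : Type*} [MeasurableSpace Ω] {μ : Measure Ω}
    [IsProbabilityMeasure μ] {g : Ω → ℝ} (hg : Integrable g μ) :
    ENNReal.ofReal (Real.exp (∫ z, g z ∂μ)) ≤ ∫⁻ z, ENNReal.ofReal (Real.exp (g z)) ∂μ := by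
  by_cases hi : Integrable (fun z => Real.exp (g z)) μ
  · rw [← ofReal_integral_eq_lintegral_ofReal hi (ae_of_all _ fun z => (Real.exp_pos _).le)]
    exact ENNReal.ofReal_le_ofReal (convexOn_exp.map_integral_le Real.continuous_exp.continuousOn
      isClosed_univ (by simp) hg hi)
  · have : ∫⁻ z, ENNReal.ofReal (Real.exp (g z)) ∂μ = ⊤ := by
      by_contra h
      refine hi ⟨Real.continuous_exp.comp_aestronglyMeasurable hg.1, ?_⟩
      rw [hasFiniteIntegral_iff_ofReal (ae_of_all _ fun z => (Real.exp_pos _).le)]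
      exact lt_top_iff_ne_top.2 h
    rw [this]
    exact le_top

lemma measurable_ofReal_exp_iSup {Ω ι : Type*} [MeasurableSpace Ω] [Finite ι] {f : ι → Ω → ℝ}
    (hf : ∀ i, Measurable (f i)) :
    Measurable fun z => ENNReal.ofReal (Real.exp (⨆ i, f i z)) :=
  (Measurable.iSup hf).exp.ennreal_ofReal

/-- Symmetrization and contraction for one observation: the centered process `∫ f i - f i z` may be
replaced by twice a symmetric process `t` that dominates the values and the increments of `f`. -/
lemma lintegral_exp_iSup_centered_le {Ω ι : Type*} [MeasurableSpace Ω] [Finite ι] [Nonempty ι]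
    {μ : Measure Ω} [IsProbabilityMeasure μ] {f t : ι → Ω → ℝ}
    (hf : ∀ i, Measurable (f i)) (hfi : ∀ i, Integrable (f i) μ) (ht : ∀ i, Measurable (t i))
    (hft : ∀ i z, |f i z| ≤ |t i z|) (hd : ∀ i j z, |f i z - f j z| ≤ |t i z - t j z|)
    (hsymm : ∀ a : ι → ℝ, ∫⁻ z, ENNReal.ofReal (Real.exp (⨆ i, (a i - 2 * t i z))) ∂μ =
      ∫⁻ z, ENNReal.ofReal (Real.exp (⨆ i, (a i + 2 * t i z))) ∂μ) (a : ι → ℝ) :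
    ∫⁻ z, ENNReal.ofReal (Real.exp (⨆ i, (a i + (∫ z', f i z' ∂μ - f i z)))) ∂μ ≤
      ∫⁻ z, ENNReal.ofReal (Real.exp (⨆ i, (a i + 2 * t i z))) ∂μ := by
  have le_sup : ∀ (f : ι → ℝ) (i : ι), f i ≤ ⨆ i, f i :=
    fun f i => le_ciSup (Finite.bddAbove_range f) i
  have half : ∀ x : ℝ, ENNReal.ofReal (x / 2) = ENNReal.ofReal x / 2 := fun x => by
    rw [ENNReal.ofReal_div_of_pos two_pos]; simp
  -- The independent copy `z'` enters through Jensen's inequality.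
  have step1 : ∀ z, ENNReal.ofReal (Real.exp (⨆ i, (a i + (∫ z', f i z' ∂μ - f i z)))) ≤
      ∫⁻ z', (ENNReal.ofReal (Real.exp (⨆ i, (a i + 2 * f i z'))) / 2 +
        ENNReal.ofReal (Real.exp (⨆ i, (a i - 2 * f i z))) / 2) ∂μ := by
    intro z
    obtain ⟨j, hj⟩ := exists_eq_ciSup_of_finite (f := fun i => a i + (∫ z', f i z' ∂μ - f i z))
    rw [← hj]
    have e : a j + (∫ z', f j z' ∂μ - f j z) = ∫ z', (f j z' + (a j - f j z)) ∂μ := by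
      rw [integral_add (hfi j) (integrable_const _)]
      simp; ring
    rw [e]
    refine (ofReal_exp_integral_le_lintegral ((hfi j).add (integrable_const _))).trans ?_
    refine lintegral_mono fun z' => ?_
    rw [← half, ← half, ← ENNReal.ofReal_add (by positivity) (by positivity)]
    refine ENNReal.ofReal_le_ofReal ?_
    have h1 := Real.exp_le_exp.2 (le_sup (fun i => a i + 2 * f i z') j)
    have h2 := Real.exp_le_exp.2 (le_sup (fun i => a i - 2 * f i z) j)
    have h3 : Real.exp (f j z' + (a j - f j z)) =
        Real.exp ((a j + 2 * f j z') / 2) * Real.exp ((a j - 2 * f j z) / 2) := by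
      rw [← Real.exp_add]; ring_nf
    have h4 : ∀ x : ℝ, Real.exp x = Real.exp (x / 2) ^ 2 := fun x => by
      rw [← Real.exp_nat_mul]; push_cast; ring_nf
    have h5 := h4 (a j + 2 * f j z')
    have h6 := h4 (a j - 2 * f j z)
    change Real.exp (f j z' + (a j - f j z)) ≤ _
    nlinarith [sq_nonneg (Real.exp ((a j + 2 * f j z') / 2) - Real.exp ((a j - 2 * f j z) / 2))]
  have mp : ∀ g : ι → Ω → ℝ, (∀ i, Measurable (g i)) →
      Measurable fun z => ENNReal.ofReal (Real.exp (⨆ i, (a i + 2 * g i z))) :=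
    fun g hg => measurable_ofReal_exp_iSup fun i => ((hg i).const_mul 2).const_add _
  have mm : ∀ g : ι → Ω → ℝ, (∀ i, Measurable (g i)) →
      Measurable fun z => ENNReal.ofReal (Real.exp (⨆ i, (a i - 2 * g i z))) :=
    fun g hg => measurable_ofReal_exp_iSup fun i => ((hg i).const_mul 2).const_sub _
  have step2 : ∀ z, ENNReal.ofReal (Real.exp (⨆ i, (a i + 2 * f i z))) / 2 +
      ENNReal.ofReal (Real.exp (⨆ i, (a i - 2 * f i z))) / 2 ≤
      ENNReal.ofReal (Real.exp (⨆ i, (a i + 2 * t i z))) / 2 +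
        ENNReal.ofReal (Real.exp (⨆ i, (a i - 2 * t i z))) / 2 := by
    intro z
    rw [← half, ← half, ← half, ← half, ← ENNReal.ofReal_add (by positivity) (by positivity),
      ← ENNReal.ofReal_add (by positivity) (by positivity)]
    refine ENNReal.ofReal_le_ofReal ?_
    have := exp_iSup_add_exp_iSup_le a (fun i => 2 * f i z) (fun i => 2 * t i z)
      (fun i => by simpa [abs_mul] using hft i z)
      (fun i j => by simpa [← mul_sub, abs_mul] using hd i j z)
    linarith
  calc _ ≤ ∫⁻ z, ∫⁻ z', (ENNReal.ofReal (Real.exp (⨆ i, (a i + 2 * f i z'))) / 2 +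
        ENNReal.ofReal (Real.exp (⨆ i, (a i - 2 * f i z))) / 2) ∂μ ∂μ := lintegral_mono step1
    _ = ∫⁻ z, (ENNReal.ofReal (Real.exp (⨆ i, (a i + 2 * f i z))) / 2 +
        ENNReal.ofReal (Real.exp (⨆ i, (a i - 2 * f i z))) / 2) ∂μ := by
      simp_rw [lintegral_add_right _ measurable_const]
      rw [lintegral_add_left measurable_const, lintegral_add_left ((mp f hf).div_const 2)]
      simp
    _ ≤ ∫⁻ z, (ENNReal.ofReal (Real.exp (⨆ i, (a i + 2 * t i z))) / 2 +
        ENNReal.ofReal (Real.exp (⨆ i, (a i - 2 * t i z))) / 2) ∂μ := lintegral_mono step2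
    _ = _ := by
      rw [lintegral_add_left ((mp t ht).div_const 2)]
      simp only [div_eq_mul_inv]
      rw [lintegral_mul_const _ (mp t ht), lintegral_mul_const _ (mm t ht), hsymm a, ← mul_add,
        ENNReal.inv_two_add_inv_two, mul_one]

/-! ### Iteration over the sample -/

lemma measurable_finCons {Ω : Type*} [MeasurableSpace Ω] {m : ℕ} :
    Measurable fun p : Ω × (Fin m → Ω) => (Fin.cons p.1 p.2 : Fin (m + 1) → Ω) := by
  refine measurable_pi_iff.2 fun i => ?_
  refine Fin.cases ?_ (fun j => ?_) i
  · simpa using measurable_fst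
  · simpa [Function.comp_def] using (measurable_pi_apply j).comp measurable_snd

lemma measurePreserving_finCons {Ω : Type*} [MeasurableSpace Ω] (μ : Measure Ω) [SigmaFinite μ]
    (m : ℕ) : MeasurePreserving (fun p : Ω × (Fin m → Ω) => (Fin.cons p.1 p.2 : Fin (m + 1) → Ω))
      (μ.prod (Measure.pi fun _ => μ)) (Measure.pi fun _ => μ) := by
  have := (measurePreserving_piFinSuccAbove (fun _ : Fin (m + 1) => μ) 0).symm
  convert! this using 1
  funext p
  exact (Fin.insertNth_zero' p.1 p.2).symm

lemma lintegral_pi_succ {Ω : Type*} [MeasurableSpace Ω] (μ : Measure Ω) [SigmaFinite μ] {m : ℕ}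
    {F : (Fin (m + 1) → Ω) → ENNReal} (hF : Measurable F) :
    ∫⁻ S, F S ∂(Measure.pi fun _ => μ) =
      ∫⁻ z, ∫⁻ S, F (Fin.cons z S) ∂(Measure.pi fun _ => μ) ∂μ := by
  rw [← (measurePreserving_finCons μ m).lintegral_comp hF,
    lintegral_prod (fun p => F (Fin.cons p.1 p.2)) (hF.comp measurable_finCons).aemeasurable]

/-- Symmetrization and contraction for a sample of size `m`, by replacing one observation at a
time; the offsets `a` carry the observations that are not being replaced. -/
lemma lintegral_exp_iSup_sum_centered_le {Ω ι : Type*} [MeasurableSpace Ω] [Finite ι] [Nonempty ι]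
    {μ : Measure Ω} [IsProbabilityMeasure μ] {f t : ι → Ω → ℝ}
    (hf : ∀ i, Measurable (f i)) (hfi : ∀ i, Integrable (f i) μ) (ht : ∀ i, Measurable (t i))
    (hft : ∀ i z, |f i z| ≤ |t i z|) (hd : ∀ i j z, |f i z - f j z| ≤ |t i z - t j z|)
    (hsymm : ∀ a : ι → ℝ, ∫⁻ z, ENNReal.ofReal (Real.exp (⨆ i, (a i - 2 * t i z))) ∂μ =
      ∫⁻ z, ENNReal.ofReal (Real.exp (⨆ i, (a i + 2 * t i z))) ∂μ) (m : ℕ) (a : ι → ℝ) :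
    ∫⁻ S, ENNReal.ofReal (Real.exp (⨆ i, (a i + ∑ k, (∫ z', f i z' ∂μ - f i (S k)))))
        ∂(Measure.pi fun _ : Fin m => μ) ≤
      ∫⁻ S, ENNReal.ofReal (Real.exp (⨆ i, (a i + ∑ k, 2 * t i (S k))))
        ∂(Measure.pi fun _ : Fin m => μ) := by
  induction m generalizing a with
  | zero => simp
  | succ m ih =>
    have mf : Measurable fun S : Fin (m + 1) → Ω =>
        ENNReal.ofReal (Real.exp (⨆ i, (a i + ∑ k, (∫ z', f i z' ∂μ - f i (S k))))) :=
      measurable_ofReal_exp_iSup fun i => (Finset.measurable_sum _ fun k _ =>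
        ((hf i).comp (measurable_pi_apply k)).const_sub _).const_add _
    have mt : Measurable fun S : Fin (m + 1) → Ω =>
        ENNReal.ofReal (Real.exp (⨆ i, (a i + ∑ k, 2 * t i (S k)))) :=
      measurable_ofReal_exp_iSup fun i => (Finset.measurable_sum _ fun k _ =>
        ((ht i).comp (measurable_pi_apply k)).const_mul _).const_add _
    have mft : Measurable fun p : Ω × (Fin m → Ω) => ENNReal.ofReal (Real.exp
        (⨆ i, ((a i + ∑ k, (∫ z', f i z' ∂μ - f i (p.2 k))) + 2 * t i p.1))) :=
      measurable_ofReal_exp_iSup fun i => ((Finset.measurable_sum _ fun k _ =>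
        ((hf i).comp ((measurable_pi_apply k).comp measurable_snd)).const_sub _).const_add _).add
          (((ht i).comp measurable_fst).const_mul _)
    rw [lintegral_pi_succ μ mf, lintegral_pi_succ μ mt, lintegral_lintegral_swap
      (f := fun z S => ENNReal.ofReal (Real.exp (⨆ i, (a i + ∑ k, (∫ z', f i z' ∂μ -
        f i ((Fin.cons z S : Fin (m + 1) → Ω) k)))))) (mf.comp measurable_finCons).aemeasurable]
    calc _ ≤ ∫⁻ S, ∫⁻ z, ENNReal.ofReal (Real.exp
          (⨆ i, ((a i + ∑ k, (∫ z', f i z' ∂μ - f i (S k))) + 2 * t i z))) ∂μ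
            ∂(Measure.pi fun _ : Fin m => μ) := by
          refine lintegral_mono fun S => ?_
          refine le_trans (le_of_eq ?_) (lintegral_exp_iSup_centered_le hf hfi ht hft hd hsymm
            fun i => a i + ∑ k, (∫ z', f i z' ∂μ - f i (S k)))
          refine lintegral_congr fun z => ?_
          congr 3
          funext i
          simp only [Fin.sum_univ_succ, Fin.cons_zero, Fin.cons_succ]
          ring
      _ = ∫⁻ z, ∫⁻ S, ENNReal.ofReal (Real.exp
          (⨆ i, ((a i + 2 * t i z) + ∑ k, (∫ z', f i z' ∂μ - f i (S k)))))
            ∂(Measure.pi fun _ : Fin m => μ) ∂μ := by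
          rw [lintegral_lintegral_swap (f := fun (S : Fin m → Ω) z => ENNReal.ofReal (Real.exp
            (⨆ i, ((a i + ∑ k, (∫ z', f i z' ∂μ - f i (S k))) + 2 * t i z))))
            (mft.comp measurable_swap).aemeasurable]
          simp only [add_right_comm]
      _ ≤ ∫⁻ z, ∫⁻ S, ENNReal.ofReal (Real.exp
          (⨆ i, ((a i + 2 * t i z) + ∑ k, 2 * t i (S k))))
            ∂(Measure.pi fun _ : Fin m => μ) ∂μ := lintegral_mono fun z => ih _
      _ = _ := by simp only [Fin.sum_univ_succ, Fin.cons_zero, Fin.cons_succ, add_assoc]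

/-! ### Duality of the trace norm -/

/-- Trace duality: the entrywise inner product of two matrices is at most the trace norm of the
first times any bound on the operator norm of the second. -/
lemma abs_sum_mul_le_traceNorm_mul {ι κ : Type} [Fintype ι] [Fintype κ] [DecidableEq κ]
    (A G : Matrix ι κ ℝ) {C : ℝ} (hC : ∀ x, ‖x‖ = 1 → ‖Matrix.toEuclideanLin G x‖ ≤ C) :
    |∑ a, ∑ c, A a c * G a c| ≤ traceNorm A * C := by
  set T := Matrix.toEuclideanLin A with hT
  set U := Matrix.toEuclideanLin G with hU
  have hsym := T.isSymmetric_adjoint_comp_self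
  set e := hsym.eigenvectorBasis rfl with he
  have htrace : ∑ a, ∑ c, A a c * G a c = ∑ i, inner ℝ (T (e i)) (U (e i)) := by
    have h1 := LinearMap.trace_eq_sum_inner (𝕜 := ℝ) (LinearMap.adjoint T ∘ₗ U) e
    have h2 := LinearMap.trace_eq_sum_inner (𝕜 := ℝ) (LinearMap.adjoint T ∘ₗ U)
      (EuclideanSpace.basisFun κ ℝ)
    rw [h1] at h2
    simp only [LinearMap.comp_apply, LinearMap.adjoint_inner_right] at h2
    rw [h2, Finset.sum_comm]
    refine Finset.sum_congr rfl fun c _ => ?_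
    simp [hT, hU, PiLp.inner_apply, Matrix.toEuclideanLin, Matrix.toLpLin_apply, mul_comm]
  have hsv : ∀ i, ‖T (e i)‖ = T.singularValues i := by
    intro i
    rw [T.singularValues_fin rfl i]
    rw [eq_comm, Real.sqrt_eq_iff_mul_self_eq
      (T.isPositive_adjoint_comp_self.nonneg_eigenvalues rfl i) (norm_nonneg _),
      ← real_inner_self_eq_norm_mul_norm, ← LinearMap.adjoint_inner_right,
      ← LinearMap.comp_apply, hsym.apply_eigenvectorBasis rfl i, ← he]
    simp [real_inner_smul_right]
  have htn : traceNorm A =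
      ∑ i : Fin (Module.finrank ℝ (EuclideanSpace ℝ κ)), T.singularValues i := by
    rw [Fin.sum_univ_eq_sum_range (fun i => T.singularValues i), traceNorm, ← hT]
    refine Finsupp.sum_of_support_subset _ (fun i hi => ?_) _ (by simp)
    by_contra h
    exact (Finsupp.mem_support_iff.1 hi) (T.singularValues_of_finrank_le (by simpa using h))
  rw [htrace, htn, Finset.sum_mul]
  refine (Finset.abs_sum_le_sum_abs _ _).trans
    (Finset.sum_le_sum fun i _ => (abs_real_inner_le_norm _ _).trans ?_)
  rw [hsv]
  exact mul_le_mul_of_nonneg_left (hC _ (e.orthonormal.1 i)) (T.singularValues_nonneg _)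

lemma traceNorm_nonneg {ι κ : Type} [Fintype ι] [Fintype κ] [DecidableEq κ] (A : Matrix ι κ ℝ) :
    0 ≤ traceNorm A :=
  Finset.sum_nonneg fun _ _ => LinearMap.singularValues_nonneg _ _

lemma overlapNorm_nonneg (W : Tensor n) : 0 ≤ overlapNorm W :=
  Finset.sum_nonneg fun _ _ => traceNorm_nonneg _

lemma traceNorm_unfold_le_overlapNorm (W : Tensor n) (k : Fin K) :
    traceNorm (unfold W k) ≤ overlapNorm W :=
  Finset.single_le_sum (f := fun k => traceNorm (unfold W k)) (fun _ _ => traceNorm_nonneg _)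
    (Finset.mem_univ k)

lemma tensorInner_eq_sum_unfold (W X : Tensor n) (k : Fin K) :
    tensorInner W X = ∑ a, ∑ c, unfold W k a c * unfold X k a c := by
  rw [tensorInner, ← Fintype.sum_prod_type']
  refine Fintype.sum_equiv (Equiv.piSplitAt k fun j => Fin (n j)) _ _ fun i => ?_
  change _ = W ((Equiv.piSplitAt k fun j => Fin (n j)).symm (Equiv.piSplitAt k _ i)) *
    X ((Equiv.piSplitAt k fun j => Fin (n j)).symm (Equiv.piSplitAt k _ i))
  rw [Equiv.symm_apply_apply]

lemma tensorInner_sub_left (V W X : Tensor n) :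
    tensorInner (V - W) X = tensorInner V X - tensorInner W X := by
  simp [tensorInner, sub_mul, Finset.sum_sub_distrib]

lemma tensorInner_neg_right (W X : Tensor n) : tensorInner W (-X) = -tensorInner W X := by
  simp [tensorInner]

lemma tensorInner_sum_right {α : Type*} (s : Finset α) (W : Tensor n) (X : α → Tensor n) :
    tensorInner W (∑ k ∈ s, X k) = ∑ k ∈ s, tensorInner W (X k) := by
  simp only [tensorInner, Finset.sum_apply, Finset.mul_sum]
  exact Finset.sum_comm

lemma measurable_tensorInner (W : Tensor n) : Measurable (tensorInner W) :=
  Finset.measurable_sum _ fun i _ => (measurable_pi_apply i).const_mul _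

/-! ### Nets -/

/-- A net of the ball of radius two: by the volumetric bound on separated sets, a maximal
`1`-separated subset is finite, with at most `5 ^ dim` elements. -/
lemma exists_net (E : Type*) [NormedAddCommGroup E] [NormedSpace ℝ E] [FiniteDimensional ℝ E] :
    ∃ s : Finset E, s.card ≤ 5 ^ Module.finrank ℝ E ∧ (∀ c ∈ s, ‖c‖ ≤ 2) ∧
      ∀ x : E, ‖x‖ ≤ 2 → ∃ c ∈ s, ‖x - c‖ ≤ 1 := by
  classical
  let P : ℕ → Prop := fun N => ∃ s : Finset E, s.card = N ∧ (∀ c ∈ s, ‖c‖ ≤ 2) ∧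
    ∀ c ∈ s, ∀ d ∈ s, c ≠ d → 1 ≤ ‖c - d‖
  have hP : ∀ N, P N → N ≤ 5 ^ Module.finrank ℝ E := by
    rintro N ⟨s, rfl, h1, h2⟩
    exact Besicovitch.card_le_of_separated s h1 h2
  obtain ⟨s, hs, h1, h2⟩ : P (Nat.findGreatest P (5 ^ Module.finrank ℝ E)) :=
    Nat.findGreatest_spec (Nat.zero_le _) ⟨∅, by simp⟩
  refine ⟨s, Besicovitch.card_le_of_separated s h1 h2, h1, fun x hx => ?_⟩
  by_contra! h
  have hxs : x ∉ s := fun hxs => by simpa using (zero_lt_one.trans (h x hxs))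
  have hP' : P (s.card + 1) := by
    refine ⟨insert x s, Finset.card_insert_of_notMem hxs, ?_, ?_⟩
    · intro c hc
      rcases Finset.mem_insert.1 hc with rfl | hc
      exacts [hx, h1 c hc]
    · intro c hc d hd hcd
      rcases Finset.mem_insert.1 hc with hcx | hc <;> rcases Finset.mem_insert.1 hd with hdx | hd
      · exact absurd (hcx.trans hdx.symm) hcd
      · rw [hcx]; exact (h d hd).le
      · rw [hdx, norm_sub_rev]; exact (h c hc).le
      · exact h2 c hc d hd hcd
  have := Nat.le_findGreatest (hP _ hP') hP'
  omega

/-- The norm of a vector is at most the maximum of its inner products with a net of the ball of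
radius two. -/
lemma norm_le_of_net {F : Type*} [NormedAddCommGroup F] [InnerProductSpace ℝ F] {t : Finset F}
    (ht : ∀ y : F, ‖y‖ ≤ 2 → ∃ d ∈ t, ‖y - d‖ ≤ 1) {y : F} {C : ℝ}
    (hC : ∀ d ∈ t, inner ℝ d y ≤ C) : ‖y‖ ≤ C := by
  -- The vector is rescaled to norm two; the rounding error `1` then costs exactly half of the
  -- norm to be bounded.
  obtain ⟨d, hd, hyd⟩ := ht ((2 * ‖y‖⁻¹) • y) (by
    rw [norm_smul, Real.norm_of_nonneg (by positivity), mul_assoc]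
    nlinarith [inv_mul_le_one (a := ‖y‖)])
  have h1 := real_inner_le_norm ((2 * ‖y‖⁻¹) • y - d) y
  rw [inner_sub_left, real_inner_smul_left, real_inner_self_eq_norm_sq] at h1
  have h2 := hC d hd
  have h3 : 2 * ‖y‖⁻¹ * ‖y‖ ^ 2 = 2 * ‖y‖ := by
    rcases eq_or_ne ‖y‖ 0 with h | h
    · simp [h]
    · field_simp
  have h4 : ‖(2 * ‖y‖⁻¹) • y - d‖ * ‖y‖ ≤ 1 * ‖y‖ :=
    mul_le_mul_of_nonneg_right hyd (norm_nonneg _)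
  linarith

/-- The operator norm of a linear map is at most the maximum of its values over a net of the ball
of radius two. -/
lemma norm_apply_le_of_net {E F : Type*} [NormedAddCommGroup E] [NormedSpace ℝ E]
    [FiniteDimensional ℝ E] [NormedAddCommGroup F] [NormedSpace ℝ F] {s : Finset E}
    (hs : ∀ x : E, ‖x‖ ≤ 2 → ∃ c ∈ s, ‖x - c‖ ≤ 1)
    (U : E →ₗ[ℝ] F) {C : ℝ} (hC : ∀ c ∈ s, ‖U c‖ ≤ C) {x : E} (hx : ‖x‖ = 1) :
    ‖U x‖ ≤ C := by
  let U' : E →L[ℝ] F := LinearMap.toContinuousLinearMap U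
  have hop : ‖U'‖ ≤ (‖U'‖ + C) / 2 := by
    have key : ∀ z : E, ‖z‖ = 1 → ‖U' z‖ ≤ (‖U'‖ + C) / 2 := by
      intro z hz
      obtain ⟨c, hc, hzc⟩ := hs ((2 : ℝ) • z) (by rw [norm_smul, hz]; norm_num)
      have h1 : U' ((2 : ℝ) • z) = U' ((2 : ℝ) • z - c) + U c := by
        rw [map_sub]; exact (sub_add_cancel _ _).symm
      have h2 : ‖U' ((2 : ℝ) • z)‖ = 2 * ‖U' z‖ := by rw [map_smul, norm_smul]; norm_num
      have h3 := norm_add_le (U' ((2 : ℝ) • z - c)) (U c)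
      have h4 : ‖U' ((2 : ℝ) • z - c)‖ ≤ ‖U'‖ * 1 :=
        (U'.le_opNorm _).trans (mul_le_mul_of_nonneg_left hzc (norm_nonneg _))
      rw [← h1, h2] at h3
      linarith [hC c hc]
    have hnn : 0 ≤ (‖U'‖ + C) / 2 := (norm_nonneg _).trans (key x hx)
    refine ContinuousLinearMap.opNorm_le_bound _ hnn fun z => ?_
    rcases eq_or_ne z 0 with rfl | hz
    · simp
    have hz' : ‖z‖ ≠ 0 := norm_ne_zero_iff.2 hz
    have := key (‖z‖⁻¹ • z) (by rw [norm_smul, norm_inv, norm_norm, inv_mul_cancel₀ hz'])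
    rw [map_smul, norm_smul, norm_inv, norm_norm, inv_mul_le_iff₀ (by positivity)] at this
    linarith
  have := U'.le_opNorm x
  rw [hx, mul_one] at this
  change ‖U' x‖ ≤ C
  linarith

/-! ### Gaussian tensors -/

/-- The moment generating function of a linear functional of a standard Gaussian tensor. -/
lemma lintegral_exp_tensorInner (w : Tensor n) :
    ∫⁻ x, ENNReal.ofReal (Real.exp (tensorInner w x)) ∂(stdGaussianTensor n) =
      ENNReal.ofReal (Real.exp (tensorInner w w / 2)) := by
  have e : (fun x : Tensor n => Real.exp (tensorInner w x)) =
      fun x => ∏ i, Real.exp (w i * x i) := by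
    funext x; rw [tensorInner, Real.exp_sum]
  have hi : ∀ i, Integrable (fun t => Real.exp (w i * t)) (gaussianReal 0 1) :=
    fun i => integrable_exp_mul_gaussianReal (w i)
  rw [stdGaussianTensor, ← ofReal_integral_eq_lintegral_ofReal _
    (ae_of_all _ fun x => (Real.exp_pos _).le), e]
  · rw [integral_fintype_prod_eq_prod (fun i t => Real.exp (w i * t))]
    congr 1
    rw [tensorInner, Finset.sum_div, Real.exp_sum]
    refine Finset.prod_congr rfl fun i _ => ?_
    have := mgf_gaussianReal (p := gaussianReal 0 1) (μ := 0) (v := 1) (X := id) (by simp) (w i)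
    simp only [mgf, id] at this
    rw [this]
    simp; ring_nf
  · rw [e]
    exact Integrable.fintype_prod hi

lemma integrable_tensorInner (w : Tensor n) : Integrable (tensorInner w) (stdGaussianTensor n) := by
  refine integrable_finsetSum _ fun i _ => Integrable.const_mul ?_ _
  exact integrable_comp_eval (μ := fun _ => gaussianReal 0 1) (f := fun t : ℝ => t)
    ((memLp_id_gaussianReal 1).integrable le_rfl)

lemma map_neg_stdGaussianTensor :
    (stdGaussianTensor n).map (fun x => -x) = stdGaussianTensor n := by
  have h : MeasurePreserving (fun t : ℝ => -t) (gaussianReal 0 1) (gaussianReal 0 1) :=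
    ⟨measurable_neg, by rw [gaussianReal_map_neg]; simp⟩
  exact (measurePreserving_pi (fun _ : (k : Fin K) → Fin (n k) => gaussianReal 0 1)
    (fun _ => gaussianReal 0 1) (fun _ => h)).map_eq

/-! ### Rank-one tensors -/

lemma card_columns_unfold (k : Fin K) :
    Fintype.card ((j : {j : Fin K // j ≠ k}) → Fin (n j)) = coDim n k := by
  rw [Fintype.card_pi, coDim]
  simp only [Fintype.card_fin]
  exact (Finset.prod_subtype _ (fun j => by simp) n).symm

/-- The tensor whose mode-`k` unfolding is the rank-one matrix `d cᵀ`. -/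
def rankOneTensor (k : Fin K) (d : EuclideanSpace ℝ (Fin (n k)))
    (c : EuclideanSpace ℝ ((j : {j : Fin K // j ≠ k}) → Fin (n j))) : Tensor n :=
  fun i => d (i k) * c fun j => i j

lemma unfold_rankOneTensor (k : Fin K) (d : EuclideanSpace ℝ (Fin (n k)))
    (c : EuclideanSpace ℝ ((j : {j : Fin K // j ≠ k}) → Fin (n j))) (a) (b) :
    unfold (rankOneTensor k d c) k a b = d a * c b := by
  have h := (Equiv.piSplitAt k fun j => Fin (n j)).apply_symm_apply (a, b)
  have h1 : ((Equiv.piSplitAt k fun j => Fin (n j)).symm (a, b)) k = a := congrArg Prod.fst h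
  have h2 : (fun j : {j : Fin K // j ≠ k} =>
    ((Equiv.piSplitAt k fun j => Fin (n j)).symm (a, b)) j) = b := congrArg Prod.snd h
  change d (((Equiv.piSplitAt k fun j => Fin (n j)).symm (a, b)) k) * c (fun j =>
    ((Equiv.piSplitAt k fun j => Fin (n j)).symm (a, b)) j) = _
  rw [h1, h2]

lemma tensorInner_rankOneTensor (k : Fin K) (d : EuclideanSpace ℝ (Fin (n k)))
    (c : EuclideanSpace ℝ ((j : {j : Fin K // j ≠ k}) → Fin (n j))) (X : Tensor n) :
    tensorInner (rankOneTensor k d c) X =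
      inner ℝ d (Matrix.toEuclideanLin (unfold X k) c) := by
  rw [tensorInner_eq_sum_unfold _ _ k, PiLp.inner_apply]
  refine Finset.sum_congr rfl fun a _ => ?_
  simp only [unfold_rankOneTensor, Matrix.toEuclideanLin, Matrix.toLpLin_apply, RCLike.inner_apply,
    conj_trivial, Matrix.mulVec, dotProduct, Finset.sum_mul]
  exact Finset.sum_congr rfl fun b _ => by ring

lemma tensorInner_rankOneTensor_self (k : Fin K) (d : EuclideanSpace ℝ (Fin (n k)))
    (c : EuclideanSpace ℝ ((j : {j : Fin K // j ≠ k}) → Fin (n j))) :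
    tensorInner (rankOneTensor k d c) (rankOneTensor k d c) = ‖d‖ ^ 2 * ‖c‖ ^ 2 := by
  rw [tensorInner_eq_sum_unfold _ _ k, EuclideanSpace.norm_sq_eq, EuclideanSpace.norm_sq_eq,
    Finset.sum_mul_sum]
  simp only [unfold_rankOneTensor, Real.norm_eq_abs, sq_abs]
  exact Finset.sum_congr rfl fun a _ => Finset.sum_congr rfl fun b _ => by ring

/-- Finitely many rank-one tensors suffice to control the inner product of a tensor `X` with every
tensor whose mode-`k` unfolding has bounded trace norm. -/
lemma exists_tensor_net (n : Fin K → ℕ) (k : Fin K) :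
    ∃ N : Finset (Tensor n), N.Nonempty ∧ N.card ≤ 5 ^ (n k + coDim n k) ∧
      (∀ v ∈ N, tensorInner v v ≤ 16) ∧
      ∀ (W X : Tensor n) (C : ℝ), (∀ v ∈ N, tensorInner v X ≤ C) →
        0 ≤ C ∧ |tensorInner W X| ≤ traceNorm (unfold W k) * C := by
  classical
  obtain ⟨s, hs, hs2, hsn⟩ :=
    exists_net (EuclideanSpace ℝ ((j : {j : Fin K // j ≠ k}) → Fin (n j)))
  obtain ⟨t, ht, ht2, htn⟩ := exists_net (EuclideanSpace ℝ (Fin (n k)))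
  rw [finrank_euclideanSpace, card_columns_unfold] at hs
  rw [finrank_euclideanSpace, Fintype.card_fin] at ht
  refine ⟨(t ×ˢ s).image fun p => rankOneTensor k p.1 p.2, ?_, ?_, ?_, ?_⟩
  · obtain ⟨c, hc, -⟩ := hsn 0 (by simp)
    obtain ⟨d, hd, -⟩ := htn 0 (by simp)
    exact ⟨_, Finset.mem_image_of_mem _ (Finset.mk_mem_product hd hc)⟩
  · refine Finset.card_image_le.trans ?_
    rw [Finset.card_product, pow_add]
    exact Nat.mul_le_mul ht hs
  · intro v hv
    obtain ⟨p, hp, rfl⟩ := Finset.mem_image.1 hv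
    rw [Finset.mem_product] at hp
    rw [tensorInner_rankOneTensor_self]
    have h1 : ‖p.1‖ ^ 2 ≤ 2 ^ 2 := pow_le_pow_left₀ (norm_nonneg _) (ht2 _ hp.1) 2
    have h2 : ‖p.2‖ ^ 2 ≤ 2 ^ 2 := pow_le_pow_left₀ (norm_nonneg _) (hs2 _ hp.2) 2
    calc _ ≤ (2 : ℝ) ^ 2 * 2 ^ 2 := mul_le_mul h1 h2 (by positivity) (by positivity)
      _ = 16 := by norm_num
  · intro W X C hC
    have hU : ∀ c ∈ s, ‖Matrix.toEuclideanLin (unfold X k) c‖ ≤ C := by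
      intro c hc
      refine norm_le_of_net htn fun d hd => ?_
      rw [← tensorInner_rankOneTensor]
      exact hC _ (Finset.mem_image_of_mem _ (Finset.mk_mem_product hd hc))
    obtain ⟨c, hc, -⟩ := hsn 0 (by simp)
    refine ⟨(norm_nonneg _).trans (hU c hc), ?_⟩
    rw [tensorInner_eq_sum_unfold W X k]
    exact abs_sum_mul_le_traceNorm_mul _ _ fun x hx => norm_apply_le_of_net hsn _ hU hx

/-! ### The exponential moment of the linear process -/

lemma lintegral_prod_pi {Ω : Type*} [MeasurableSpace Ω] (μ : Measure Ω) [SigmaFinite μ]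
    {g : Ω → ENNReal} (hg : Measurable g) (m : ℕ) :
    ∫⁻ S, ∏ k, g (S k) ∂(Measure.pi fun _ : Fin m => μ) = (∫⁻ z, g z ∂μ) ^ m := by
  induction m with
  | zero => simp
  | succ m ih =>
    have hprod : ∀ l : ℕ, Measurable fun S : Fin l → Ω => ∏ k, g (S k) := fun l =>
      Finset.measurable_prod _ fun k _ => hg.comp (measurable_pi_apply k)
    rw [lintegral_pi_succ μ (hprod _)]
    simp only [Fin.prod_univ_succ, Fin.cons_zero, Fin.cons_succ]
    simp_rw [lintegral_const_mul _ (hprod m)]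
    rw [ih, lintegral_mul_const _ hg, pow_succ']

/-- Exponential moment of the supremum of the Gaussian process `∑ k, ⟨w i, X k⟩` over differences
`w i` of tensors in the overlapped-trace-norm ball: a union bound over a net of rank-one tensors. -/
lemma lintegral_exp_iSup_tensorInner_le {𝒴 ι : Type*} [MeasurableSpace 𝒴] [Finite ι] [Nonempty ι]
    {μ : Measure (Tensor n × 𝒴)} [IsProbabilityMeasure μ]
    (hμ : μ.map Prod.fst = stdGaussianTensor n) {B₀ : ℝ} {w : ι → Tensor n} {W₀ : Tensor n}
    (hw : ∀ i, overlapNorm (w i) ≤ B₀) (hW₀ : overlapNorm W₀ ≤ B₀) (k : Fin K) (m : ℕ)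
    {τ : ℝ} (hτ : 0 ≤ τ) :
    ∫⁻ S, ENNReal.ofReal (Real.exp (⨆ i, ∑ j, 2 * (τ * tensorInner (w i - W₀) (S j).1)))
        ∂(Measure.pi fun _ : Fin m => μ) ≤
      ENNReal.ofReal (Real.exp (2 * (n k + coDim n k) + 128 * τ ^ 2 * B₀ ^ 2 * m)) := by
  obtain ⟨N, hN, hNcard, hNsq, hNnet⟩ := exists_tensor_net n k
  have hgauss : ∀ v : Tensor n, ∫⁻ z, ENNReal.ofReal (Real.exp (tensorInner v z.1)) ∂μ =
      ENNReal.ofReal (Real.exp (tensorInner v v / 2)) := by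
    intro v
    rw [← lintegral_exp_tensorInner, ← hμ,
      lintegral_map (measurable_tensorInner v).exp.ennreal_ofReal measurable_fst]
  have hmeas : ∀ v : Tensor n, Measurable fun z : Tensor n × 𝒴 =>
      ENNReal.ofReal (Real.exp (tensorInner v z.1)) :=
    fun v => ((measurable_tensorInner v).comp measurable_fst).exp.ennreal_ofReal
  have hsmul : ∀ (c : ℝ) (v X : Tensor n), tensorInner (c • v) X = c * tensorInner v X := by
    intro c v X
    simp [tensorInner, Finset.mul_sum, mul_assoc]
  have hsmul' : ∀ (c : ℝ) (v X : Tensor n), tensorInner v (c • X) = c * tensorInner v X := by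
    intro c v X
    simp [tensorInner, Finset.mul_sum, mul_left_comm]
  -- Both `w i` and `W₀` contribute `B₀` times the maximum over the net, hence `4 * τ * B₀`; with
  -- net tensors of squared norm at most `16`, each Gaussian factor has exponent at most
  -- `(4 * τ * B₀) ^ 2 * 16 / 2`.
  have hpt : ∀ S : Fin m → Tensor n × 𝒴,
      ENNReal.ofReal (Real.exp (⨆ i, ∑ j, 2 * (τ * tensorInner (w i - W₀) (S j).1))) ≤
        ∑ v ∈ N, ∏ j, ENNReal.ofReal (Real.exp (tensorInner ((4 * τ * B₀) • v) (S j).1)) := by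
    intro S
    obtain ⟨v, hv, hmax⟩ := N.exists_max_image (fun v => tensorInner v (∑ j, (S j).1)) hN
    refine le_trans ?_ (Finset.single_le_sum (f := fun v => ∏ j, ENNReal.ofReal
      (Real.exp (tensorInner ((4 * τ * B₀) • v) (S j).1))) (fun _ _ => zero_le) hv)
    rw [← ENNReal.ofReal_prod_of_nonneg fun _ _ => (Real.exp_pos _).le, ← Real.exp_sum]
    refine ENNReal.ofReal_le_ofReal (Real.exp_le_exp.2 (ciSup_le fun i => ?_))
    rw [← tensorInner_sum_right, hsmul, ← Finset.mul_sum, ← Finset.mul_sum,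
      ← tensorInner_sum_right, tensorInner_sub_left]
    have hbound : ∀ V : Tensor n, overlapNorm V ≤ B₀ →
        |tensorInner V (∑ j, (S j).1)| ≤ B₀ * tensorInner v (∑ j, (S j).1) := fun V hV =>
      (hNnet V _ _ hmax).2.trans (mul_le_mul_of_nonneg_right
        ((traceNorm_unfold_le_overlapNorm V k).trans hV) (hNnet V _ _ hmax).1)
    have h1 := (abs_le.1 (hbound _ (hw i))).2
    have h2 := (abs_le.1 (hbound _ hW₀)).1
    nlinarith
  refine (lintegral_mono hpt).trans ?_
  rw [lintegral_finsetSum (f := fun v (S : Fin m → Tensor n × 𝒴) =>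
    ∏ j, ENNReal.ofReal (Real.exp (tensorInner ((4 * τ * B₀) • v) (S j).1))) N fun v _ =>
      Finset.measurable_prod _ fun j _ => (hmeas _).comp (measurable_pi_apply j)]
  have hterm : ∀ v ∈ N, ∫⁻ S, ∏ j, ENNReal.ofReal
      (Real.exp (tensorInner ((4 * τ * B₀) • v) (S j).1)) ∂(Measure.pi fun _ : Fin m => μ) ≤
      ENNReal.ofReal (Real.exp (128 * τ ^ 2 * B₀ ^ 2 * m)) := by
    intro v hv
    rw [lintegral_prod_pi μ (hmeas ((4 * τ * B₀) • v)) m, hgauss,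
      ← ENNReal.ofReal_pow (by positivity), ← Real.exp_nat_mul]
    refine ENNReal.ofReal_le_ofReal (Real.exp_le_exp.2 ?_)
    rw [hsmul, hsmul']
    have := mul_le_mul_of_nonneg_left (hNsq v hv) (by positivity : 0 ≤ (m : ℝ) * (8 * (τ * B₀) ^ 2))
    linarith
  refine (Finset.sum_le_sum hterm).trans ?_
  rw [Finset.sum_const, nsmul_eq_mul, ← ENNReal.ofReal_natCast,
    ← ENNReal.ofReal_mul (Nat.cast_nonneg _), Real.exp_add]
  refine ENNReal.ofReal_le_ofReal (mul_le_mul_of_nonneg_right ?_ (Real.exp_pos _).le)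
  have h5 : (5 : ℝ) ≤ Real.exp 2 := by
    have h := Real.exp_one_gt_d9
    rw [show (2 : ℝ) = 1 + 1 by norm_num, Real.exp_add]
    nlinarith
  calc (N.card : ℝ) ≤ 5 ^ (n k + coDim n k) := by exact_mod_cast hNcard
    _ ≤ Real.exp 2 ^ (n k + coDim n k) := pow_le_pow_left₀ (by norm_num) h5 _
    _ = _ := by rw [← Real.exp_nat_mul]; push_cast; ring_nf

/-! ### Bounded differences and Chernoff bounds -/

lemma abs_integral_le_of_forall_abs_le {Ω : Type*} [MeasurableSpace Ω] {μ : Measure Ω}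
    [IsProbabilityMeasure μ] {g : Ω → ℝ} {C : ℝ} (h : ∀ z, |g z| ≤ C) : |∫ z, g z ∂μ| ≤ C := by
  have := norm_integral_le_of_norm_le_const (μ := μ) (f := g) (ae_of_all _ fun z => h z)
  rwa [probReal_univ, mul_one] at this

lemma abs_iSup_sub_iSup_le {ι : Type*} [Finite ι] [Nonempty ι] {f g : ι → ℝ} {c : ℝ}
    (h : ∀ i, |f i - g i| ≤ c) : |(⨆ i, f i) - ⨆ i, g i| ≤ c := by
  have le_sup : ∀ (f : ι → ℝ) (i : ι), f i ≤ ⨆ i, f i :=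
    fun f i => le_ciSup (Finite.bddAbove_range f) i
  rw [abs_le]
  constructor
  · have : ⨆ i, g i ≤ (⨆ i, f i) + c :=
      ciSup_le fun i => by linarith [(abs_le.1 (h i)).1, le_sup f i]
    linarith
  · have : ⨆ i, f i ≤ (⨆ i, g i) + c :=
      ciSup_le fun i => by linarith [(abs_le.1 (h i)).2, le_sup g i]
    linarith

/-- McDiarmid's inequality, as a bound on the moment generating function: a bounded function of `m`
independent observations that moves by at most `c` when one observation changes is sub-Gaussian
with variance proxy `m * c ^ 2 / 4`. -/
lemma lintegral_exp_sub_integral_le_of_bounded_differences {Ω : Type*} [MeasurableSpace Ω]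
    {μ : Measure Ω} [IsProbabilityMeasure μ] {m : ℕ} {F : (Fin m → Ω) → ℝ} (hF : Measurable F)
    {C c : ℝ} (hC : ∀ S, |F S| ≤ C) (hd : ∀ S i z, |F (Function.update S i z) - F S| ≤ c) (l : ℝ) :
    ∫⁻ S, ENNReal.ofReal (Real.exp (l * (F S - ∫ S', F S' ∂(Measure.pi fun _ => μ))))
        ∂(Measure.pi fun _ : Fin m => μ) ≤
      ENNReal.ofReal (Real.exp (m * c ^ 2 / 4 * l ^ 2 / 2)) := by
  induction m with
  | zero => simp [Subsingleton.elim _ (default : Fin 0 → Ω)]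
  | succ m ih =>
    have : Nonempty Ω := nonempty_of_isProbabilityMeasure μ
    have hFc : Measurable fun p : Ω × (Fin m → Ω) => F (Fin.cons p.1 p.2) :=
      hF.comp measurable_finCons
    set g : Ω → ℝ := fun z => ∫ S, F (Fin.cons z S) ∂(Measure.pi fun _ : Fin m => μ) with hg
    have hgm : Measurable g := (hFc.stronglyMeasurable.integral_prod_right').measurable
    have hint : ∀ z, Integrable (fun S : Fin m → Ω => F (Fin.cons z S))
        (Measure.pi fun _ : Fin m => μ) := fun z =>
      Integrable.of_bound (hFc.comp measurable_prodMk_left).aestronglyMeasurable C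
        (ae_of_all _ fun S => hC _)
    have hmean : ∫ S, F S ∂(Measure.pi fun _ : Fin (m + 1) => μ) = ∫ z, g z ∂μ := by
      rw [← (measurePreserving_finCons μ m).map_eq,
        integral_map measurable_finCons.aemeasurable hF.aestronglyMeasurable]
      exact integral_prod _ (Integrable.of_bound hFc.aestronglyMeasurable C
        (ae_of_all _ fun p => hC _))
    have hgd : ∀ z z', |g z - g z'| ≤ c := by
      intro z z'
      rw [hg]
      simp only
      rw [← integral_sub (hint z) (hint z')]
      refine abs_integral_le_of_forall_abs_le fun S => ?_
      have := hd (Fin.cons z' S : Fin (m + 1) → Ω) 0 z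
      rwa [Fin.update_cons_zero] at this
    have hc : 0 ≤ c := (abs_nonneg _).trans (hgd (Classical.arbitrary Ω) (Classical.arbitrary Ω))
    have hgC : ∀ z, |g z| ≤ C := fun z =>
      abs_integral_le_of_forall_abs_le fun S => hC _
    have hbdd : BddBelow (Set.range g) := ⟨-C, by rintro _ ⟨z, rfl⟩; exact (abs_le.1 (hgC z)).1⟩
    have hsub := hasSubgaussianMGF_of_mem_Icc (μ := μ) (X := g) (a := ⨅ z, g z)
      (b := (⨅ z, g z) + c) hgm.aemeasurable (ae_of_all _ fun z => ⟨ciInf_le hbdd z, by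
        have : g z - c ≤ ⨅ z, g z := le_ciInf fun z' => by linarith [(abs_le.1 (hgd z z')).2]
        linarith⟩)
    have hhoeff : ∫⁻ z, ENNReal.ofReal (Real.exp (l * (g z - ∫ z', g z' ∂μ))) ∂μ ≤
        ENNReal.ofReal (Real.exp (c ^ 2 / 4 * l ^ 2 / 2)) := by
      rw [← ofReal_integral_eq_lintegral_ofReal (hsub.integrable_exp_mul l)
        (ae_of_all _ fun z => (Real.exp_pos _).le)]
      refine ENNReal.ofReal_le_ofReal ((hsub.mgf_le l).trans (le_of_eq ?_))
      rw [add_sub_cancel_left]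
      push_cast
      rw [Real.norm_eq_abs, div_pow, sq_abs]
      norm_num
    have hexp : ∀ d : ℝ, Measurable fun S : Fin (m + 1) → Ω =>
        ENNReal.ofReal (Real.exp (l * (F S - d))) := fun d =>
      ((hF.sub_const d).const_mul l).exp.ennreal_ofReal
    rw [hmean, lintegral_pi_succ μ (hexp _)]
    calc _ = ∫⁻ z, (∫⁻ S, ENNReal.ofReal (Real.exp (l * (F (Fin.cons z S) - g z)))
            ∂(Measure.pi fun _ : Fin m => μ)) *
              ENNReal.ofReal (Real.exp (l * (g z - ∫ z', g z' ∂μ))) ∂μ := by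
          refine lintegral_congr fun z => ?_
          have hFz : Measurable fun S : Fin m → Ω => F (Fin.cons z S) :=
            hFc.comp measurable_prodMk_left
          rw [← lintegral_mul_const _ ((hFz.sub_const (g z)).const_mul l).exp.ennreal_ofReal]
          refine lintegral_congr fun S => ?_
          rw [← ENNReal.ofReal_mul (Real.exp_pos _).le, ← Real.exp_add]
          ring_nf
      _ ≤ ∫⁻ z, ENNReal.ofReal (Real.exp (m * c ^ 2 / 4 * l ^ 2 / 2)) *
              ENNReal.ofReal (Real.exp (l * (g z - ∫ z', g z' ∂μ))) ∂μ := by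
          refine lintegral_mono fun z => mul_le_mul_left ?_ _
          refine ih (F := fun S => F (Fin.cons z S)) (hFc.comp measurable_prodMk_left)
            (fun S => hC _) fun S i z' => ?_
          have := hd (Fin.cons z S : Fin (m + 1) → Ω) i.succ z'
          rwa [← Fin.cons_update] at this
      _ ≤ _ := by
          rw [lintegral_const_mul _ ((hgm.sub_const _).const_mul l).exp.ennreal_ofReal]
          refine (mul_le_mul_right hhoeff _).trans (le_of_eq ?_)
          rw [← ENNReal.ofReal_mul (Real.exp_pos _).le, ← Real.exp_add]
          push_cast
          ring_nf

/-- Chernoff's bound for a variable with moment generating function at most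
`exp (D + V * l ^ 2 / 2)`. -/
lemma measure_le_of_lintegral_exp_le {Ω : Type*} [MeasurableSpace Ω] {μ : Measure Ω} {Z : Ω → ℝ}
    (hZ : Measurable Z) {D V L s : ℝ} (hD : 0 ≤ D) (hL : 0 ≤ L)
    (h : ∀ l, 0 ≤ l → ∫⁻ z, ENNReal.ofReal (Real.exp (l * Z z)) ∂μ ≤
      ENNReal.ofReal (Real.exp (D + V * l ^ 2 / 2)))
    (hs : √(2 * V * (D + L)) < s) : μ {z | s ≤ Z z} ≤ ENNReal.ofReal (Real.exp (-L)) := by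
  have hs0 : 0 < s := (Real.sqrt_nonneg _).trans_lt hs
  have hs2 : 2 * V * (D + L) ≤ s ^ 2 := ((Real.sqrt_lt' hs0).1 hs).le
  -- This value of the parameter needs no case distinction on `V = 0`, unlike the optimal `s / V`.
  set l := 2 * (D + L) / s with hl
  have hl0 : 0 ≤ l := by positivity
  have hsub : {z | s ≤ Z z} ⊆
      {z | ENNReal.ofReal (Real.exp (l * s)) ≤ ENNReal.ofReal (Real.exp (l * Z z))} :=
    fun z hz => ENNReal.ofReal_le_ofReal (Real.exp_le_exp.2 (mul_le_mul_of_nonneg_left hz hl0))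
  have hmk := (mul_meas_ge_le_lintegral ((hZ.const_mul l).exp.ennreal_ofReal)
    (ENNReal.ofReal (Real.exp (l * s)))).trans (h l hl0)
  have hpos : ENNReal.ofReal (Real.exp (l * s)) ≠ 0 := by
    simpa using Real.exp_pos _
  rw [mul_comm] at hmk
  refine (measure_mono hsub).trans (((ENNReal.le_div_iff_mul_le (Or.inl hpos)
    (Or.inl ENNReal.ofReal_ne_top)).2 hmk).trans ?_)
  rw [← ENNReal.ofReal_div_of_pos (Real.exp_pos _), ← Real.exp_sub]
  refine ENNReal.ofReal_le_ofReal (Real.exp_le_exp.2 ?_)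
  have h1 : l * s = 2 * (D + L) := by rw [hl]; field_simp
  have h2 : V * l ^ 2 / 2 ≤ D + L := by
    have h3 : V * l ^ 2 / 2 = 2 * V * (D + L) * (D + L) / s ^ 2 := by rw [hl]; field_simp
    rw [h3, div_le_iff₀ (by positivity), mul_comm (D + L)]
    exact mul_le_mul_of_nonneg_right hs2 (by positivity)
  linarith

lemma integral_le_of_lintegral_exp_le {Ω : Type*} [MeasurableSpace Ω] {μ : Measure Ω}
    [IsProbabilityMeasure μ] {Z : Ω → ℝ} (hZ : Integrable Z μ) {D V : ℝ} (hV : 0 ≤ V)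
    (h : ∀ l, 0 ≤ l → ∫⁻ z, ENNReal.ofReal (Real.exp (l * Z z)) ∂μ ≤
      ENNReal.ofReal (Real.exp (D + V * l ^ 2 / 2))) : ∫ z, Z z ∂μ ≤ √(2 * V * D) := by
  set x := ∫ z, Z z ∂μ with hx
  have key : ∀ l, 0 ≤ l → l * x ≤ D + V * l ^ 2 / 2 := by
    intro l hl
    have h1 := (ofReal_exp_integral_le_lintegral (hZ.const_mul l)).trans (h l hl)
    rwa [integral_const_mul, ← hx, ENNReal.ofReal_le_ofReal_iff (Real.exp_pos _).le,
      Real.exp_le_exp] at h1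
  by_contra! hlt
  have hx0 : 0 < x := (Real.sqrt_nonneg _).trans_lt hlt
  have hx2 : 2 * V * D < x ^ 2 := (Real.sqrt_lt' hx0).1 hlt
  rcases hV.eq_or_lt with rfl | hV
  · have h1 := key ((|D| + 1) / x) (by positivity)
    rw [div_mul_cancel₀ _ hx0.ne'] at h1
    linarith [le_abs_self D]
  · have h1 := key (x / V) (by positivity)
    have h2 : x / V * x - V * (x / V) ^ 2 / 2 = x ^ 2 / (2 * V) := by field_simp; ring
    have h3 : x ^ 2 / (2 * V) ≤ D := by linarith
    rw [div_le_iff₀ (by positivity)] at h3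
    linarith

/-! ### The excess risk process -/

/-- The amount by which the empirical excess risk of `W` relative to `W₀` on the sample `S` falls
short of its expectation. -/
def excessRiskGap {𝒴 : Type*} [MeasurableSpace 𝒴] (ℓ : ℝ → 𝒴 → ℝ) (μ : Measure (Tensor n × 𝒴))
    (W₀ : Tensor n) {m : ℕ} (S : Fin m → Tensor n × 𝒴) (W : Tensor n) : ℝ :=
  (risk ℓ μ W - risk ℓ μ W₀) - (empiricalRisk ℓ S W - empiricalRisk ℓ S W₀)

lemma abs_loss_sub_le {𝒴 : Type*} {ℓ : ℝ → 𝒴 → ℝ} {Λ : NNReal}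
    (hΛ : ∀ y, LipschitzWith Λ fun t => ℓ t y) (V W : Tensor n) (z : Tensor n × 𝒴) :
    |ℓ (tensorInner V z.1) z.2 - ℓ (tensorInner W z.1) z.2| ≤
      Λ * |tensorInner V z.1 - tensorInner W z.1| := by
  simpa [Real.dist_eq] using (hΛ z.2).dist_le_mul (tensorInner V z.1) (tensorInner W z.1)

section
variable {𝒴 : Type*} [MeasurableSpace 𝒴] {ℓ : ℝ → 𝒴 → ℝ} {Λ : NNReal} {μ : Measure (Tensor n × 𝒴)}

lemma measurable_loss (hℓ : Measurable (Function.uncurry ℓ)) (W : Tensor n) :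
    Measurable fun z : Tensor n × 𝒴 => ℓ (tensorInner W z.1) z.2 :=
  hℓ.comp (((measurable_tensorInner W).comp measurable_fst).prodMk measurable_snd)

lemma integrable_tensorInner_fst (hμ : μ.map Prod.fst = stdGaussianTensor n) (W : Tensor n) :
    Integrable (fun z : Tensor n × 𝒴 => tensorInner W z.1) μ := by
  have h := integrable_tensorInner W
  rw [← hμ] at h
  exact h.comp_measurable measurable_fst

lemma integrable_loss (hℓ : Measurable (Function.uncurry ℓ))
    (hΛ : ∀ y, LipschitzWith Λ fun t => ℓ t y) (hμ : μ.map Prod.fst = stdGaussianTensor n)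
    (h0 : Integrable (fun z => ℓ 0 z.2) μ) (W : Tensor n) :
    Integrable (fun z => ℓ (tensorInner W z.1) z.2) μ := by
  refine (h0.abs.add ((integrable_tensorInner_fst hμ W).abs.const_mul Λ)).mono'
    (measurable_loss hℓ W).aestronglyMeasurable (ae_of_all _ fun z => ?_)
  have h1 := (hΛ z.2).dist_le_mul (tensorInner W z.1) 0
  simp only [Real.dist_eq, sub_zero] at h1
  have h2 := abs_add_le (ℓ (tensorInner W z.1) z.2 - ℓ 0 z.2) (ℓ 0 z.2)
  rw [sub_add_cancel] at h2
  rw [Real.norm_eq_abs]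
  simp only [Pi.add_apply]
  linarith

lemma continuous_tensorInner_left (X : Tensor n) : Continuous fun W : Tensor n => tensorInner W X :=
  continuous_finsetSum _ fun i _ => (continuous_apply i).mul continuous_const

lemma continuous_risk (hℓ : Measurable (Function.uncurry ℓ))
    (hΛ : ∀ y, LipschitzWith Λ fun t => ℓ t y) (hμ : μ.map Prod.fst = stdGaussianTensor n)
    (h0 : Integrable (fun z => ℓ 0 z.2) μ) : Continuous (risk ℓ μ) := by
  classical
  have hb : ∀ i, Integrable (fun z : Tensor n × 𝒴 => |z.1 i|) μ := fun i => by
    have := (integrable_tensorInner_fst hμ (Pi.single i 1)).abs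
    simpa [tensorInner, Pi.single_apply] using this
  have hle : ∀ V W : Tensor n,
      |risk ℓ μ V - risk ℓ μ W| ≤ ∑ i, Λ * |V i - W i| * ∫ z, |z.1 i| ∂μ := by
    intro V W
    rw [risk, risk, ← integral_sub (integrable_loss hℓ hΛ hμ h0 V) (integrable_loss hℓ hΛ hμ h0 W)]
    simp_rw [← integral_const_mul]
    rw [← integral_finsetSum _ fun i _ => (hb i).const_mul _]
    refine norm_integral_le_of_norm_le (G := ℝ)
      (integrable_finsetSum _ fun i _ => (hb i).const_mul _) (ae_of_all _ fun z => ?_)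
    refine (abs_loss_sub_le hΛ V W z).trans ?_
    rw [← tensorInner_sub_left, tensorInner]
    simp_rw [mul_assoc]
    rw [← Finset.mul_sum]
    refine mul_le_mul_of_nonneg_left ((Finset.abs_sum_le_sum_abs _ _).trans ?_) Λ.coe_nonneg
    simp [abs_mul]
  rw [continuous_iff_continuousAt]
  intro W
  rw [ContinuousAt, tendsto_iff_norm_sub_tendsto_zero]
  refine squeeze_zero (fun _ => norm_nonneg _) (fun V => hle V W) ?_
  have hc : Continuous fun V : Tensor n => ∑ i, (Λ : ℝ) * |V i - W i| * ∫ z, |z.1 i| ∂μ := by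
    fun_prop
  simpa using hc.tendsto W

lemma continuous_excessRiskGap (hℓ : Measurable (Function.uncurry ℓ))
    (hΛ : ∀ y, LipschitzWith Λ fun t => ℓ t y) (hμ : μ.map Prod.fst = stdGaussianTensor n)
    (h0 : Integrable (fun z => ℓ 0 z.2) μ) (W₀ : Tensor n) {m : ℕ} (S : Fin m → Tensor n × 𝒴) :
    Continuous (excessRiskGap ℓ μ W₀ S) := by
  refine ((continuous_risk hℓ hΛ hμ h0).sub continuous_const).sub
    ((continuous_const.mul (continuous_finsetSum _ fun i _ => ?_)).sub continuous_const)
  exact (hΛ _).continuous.comp (continuous_tensorInner_left _)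

lemma measurable_iSup_excessRiskGap {ι : Type*} [Finite ι] (hℓ : Measurable (Function.uncurry ℓ))
    (W₀ : Tensor n) {m : ℕ} (w : ι → Tensor n) :
    Measurable fun S : Fin m → Tensor n × 𝒴 => ⨆ i, excessRiskGap ℓ μ W₀ S (w i) := by
  have h : ∀ W : Tensor n, Measurable fun S : Fin m → Tensor n × 𝒴 => empiricalRisk ℓ S W :=
    fun W => (Finset.measurable_sum _ fun i _ =>
      (measurable_loss hℓ W).comp (measurable_pi_apply i)).const_mul _
  exact Measurable.iSup fun i => ((h (w i)).sub (h W₀)).const_sub _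

/-- The reduction of the excess risk bound to finite families of competitors: the gap is continuous
in the competitor, so the failure event is the increasing union of those of the initial segments
of a dense sequence, with thresholds that decrease to `ε`. -/
lemma excessRiskAtMost_of_finite_families (hℓ : Measurable (Function.uncurry ℓ))
    (hΛ : ∀ y, LipschitzWith Λ fun t => ℓ t y) (hμ : μ.map Prod.fst = stdGaussianTensor n)
    (h0 : Integrable (fun z => ℓ 0 z.2) μ) {W₀ : Tensor n} {B₀ : ℝ} (hW₀ : overlapNorm W₀ ≤ B₀)
    {m : ℕ} {ε δ : ℝ}
    (h : ∀ (N : ℕ) (w : Fin (N + 1) → Tensor n), (∀ i, overlapNorm (w i) ≤ B₀) → ∀ s, ε < s →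
      (Measure.pi fun _ : Fin m => μ) {S | s ≤ ⨆ i, excessRiskGap ℓ μ W₀ S (w i)} ≤
        ENNReal.ofReal δ) : ExcessRiskAtMost ℓ μ m B₀ W₀ ε δ := by
  let ball := {W : Tensor n // overlapNorm W ≤ B₀}
  have : Nonempty ball := ⟨⟨W₀, hW₀⟩⟩
  let w : ℕ → ball := TopologicalSpace.denseSeq ball
  let A : ℕ → Set (Fin m → Tensor n × 𝒴) := fun N =>
    {S | ε + 1 / ((N : ℝ) + 1) ≤ ⨆ i : Fin (N + 1), excessRiskGap ℓ μ W₀ S (w i)}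
  have hA : Monotone A := by
    refine monotone_nat_of_le_succ fun N S hS => ?_
    have h1 : 1 / (((N + 1 : ℕ) : ℝ) + 1) ≤ 1 / ((N : ℝ) + 1) := by
      push_cast
      exact one_div_le_one_div_of_le (by positivity) (by linarith)
    have h2 : ⨆ i : Fin (N + 1), excessRiskGap ℓ μ W₀ S (w i) ≤
        ⨆ i : Fin (N + 1 + 1), excessRiskGap ℓ μ W₀ S (w i) :=
      ciSup_le fun i => le_ciSup (f := fun i : Fin (N + 1 + 1) => excessRiskGap ℓ μ W₀ S (w i))
        (Finite.bddAbove_range _) i.castSucc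
    exact (add_le_add_right h1 ε).trans (le_trans hS h2)
  refine (measure_mono (t := ⋃ N, A N) ?_).trans ?_
  · rintro S ⟨What, ⟨hball, hmin⟩, hε⟩
    have hgap : ε < excessRiskGap ℓ μ W₀ S What := by
      rw [excessRiskGap]
      linarith [hmin W₀ hW₀]
    obtain ⟨i, hi⟩ := (TopologicalSpace.denseRange_denseSeq ball).exists_mem_open
      (isOpen_lt continuous_const
        ((continuous_excessRiskGap hℓ hΛ hμ h0 W₀ S).comp continuous_subtype_val))
      ⟨⟨What, hball⟩, hgap⟩
    obtain ⟨j, hj⟩ := exists_nat_one_div_lt (K := ℝ) (sub_pos.2 hi)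
    refine Set.mem_iUnion.2 ⟨max i j, ?_⟩
    have h1 : 1 / (((max i j : ℕ) : ℝ) + 1) ≤ 1 / ((j : ℝ) + 1) :=
      one_div_le_one_div_of_le (by positivity) (by simp)
    have h2 := le_ciSup (f := fun i : Fin (max i j + 1) => excessRiskGap ℓ μ W₀ S (w i))
        (Finite.bddAbove_range _) ⟨i, by omega⟩
    simp only [Function.comp] at hj
    change ε + 1 / (((max i j : ℕ) : ℝ) + 1) ≤ _
    refine le_trans ?_ h2
    change _ ≤ excessRiskGap ℓ μ W₀ S (TopologicalSpace.denseSeq ball i)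
    linarith
  · rw [hA.measure_iUnion]
    exact iSup_le fun N => h N (fun i => w i) (fun i => (w i).2) _
      (lt_add_of_pos_right _ (by positivity))

/-- The moment generating function of the supremum of the excess risk gap over a finite family in
the overlapped-trace-norm ball. -/
lemma lintegral_exp_iSup_excessRiskGap_le {ι : Type*} [Finite ι] [Nonempty ι]
    [IsProbabilityMeasure μ] (hℓ : Measurable (Function.uncurry ℓ))
    (hΛ : ∀ y, LipschitzWith Λ fun t => ℓ t y) (hμ : μ.map Prod.fst = stdGaussianTensor n)
    (h0 : Integrable (fun z => ℓ 0 z.2) μ) {W₀ : Tensor n} {B₀ : ℝ} {w : ι → Tensor n}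
    (hw : ∀ i, overlapNorm (w i) ≤ B₀) (hW₀ : overlapNorm W₀ ≤ B₀) (k : Fin K) {m : ℕ} (hm : 1 ≤ m)
    {l : ℝ} (hl : 0 ≤ l) :
    ∫⁻ S, ENNReal.ofReal (Real.exp (l * ⨆ i, excessRiskGap ℓ μ W₀ S (w i)))
        ∂(Measure.pi fun _ : Fin m => μ) ≤
      ENNReal.ofReal (Real.exp (2 * (n k + coDim n k) +
        256 * (Λ * B₀) ^ 2 / m * l ^ 2 / 2)) := by
  have hm0 : (0 : ℝ) < m := by exact_mod_cast hm
  set f : ι → Tensor n × 𝒴 → ℝ := fun i z =>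
    l / m * (ℓ (tensorInner (w i) z.1) z.2 - ℓ (tensorInner W₀ z.1) z.2) with hf
  set t : ι → Tensor n × 𝒴 → ℝ := fun i z => l * Λ / m * tensorInner (w i - W₀) z.1 with ht
  have htm : ∀ i, Measurable (t i) := fun i =>
    ((measurable_tensorInner _).comp measurable_fst).const_mul _
  have hlm : 0 ≤ l / m := by positivity
  have hsymm : ∀ a : ι → ℝ, ∫⁻ z, ENNReal.ofReal (Real.exp (⨆ i, (a i - 2 * t i z))) ∂μ =
      ∫⁻ z, ENNReal.ofReal (Real.exp (⨆ i, (a i + 2 * t i z))) ∂μ := by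
    intro a
    have hG : Measurable fun x : Tensor n => ENNReal.ofReal (Real.exp
        (⨆ i, (a i + 2 * (l * Λ / m * tensorInner (w i - W₀) x)))) :=
      measurable_ofReal_exp_iSup fun i =>
        (((measurable_tensorInner _).const_mul _).const_mul _).const_add _
    have h1 : ∫⁻ z, ENNReal.ofReal (Real.exp (⨆ i, (a i + 2 * t i z))) ∂μ =
        ∫⁻ x, ENNReal.ofReal (Real.exp (⨆ i, (a i + 2 * (l * Λ / m * tensorInner (w i - W₀) x))))
          ∂(stdGaussianTensor n) := by
      rw [← hμ, lintegral_map hG measurable_fst]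
    have hG' : Measurable fun x : Tensor n => ENNReal.ofReal (Real.exp
        (⨆ i, (a i + 2 * (l * Λ / m * tensorInner (w i - W₀) (-x))))) := hG.comp measurable_neg
    rw [h1, ← map_neg_stdGaussianTensor, lintegral_map hG measurable_neg, ← hμ,
      lintegral_map hG' measurable_fst]
    simp only [tensorInner_neg_right, ht, mul_neg, ← sub_eq_add_neg]
  have hmain := lintegral_exp_iSup_sum_centered_le (μ := μ) (f := f) (t := t)
    (fun i => ((measurable_loss hℓ _).sub (measurable_loss hℓ _)).const_mul _)
    (fun i => ((integrable_loss hℓ hΛ hμ h0 _).sub (integrable_loss hℓ hΛ hμ h0 _)).const_mul _)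
    htm
    (fun i z => by
      simp only [hf, ht, abs_mul, abs_of_nonneg hlm, abs_div, abs_of_nonneg hl,
        abs_of_pos hm0, NNReal.abs_eq, tensorInner_sub_left]
      have := mul_le_mul_of_nonneg_left (abs_loss_sub_le hΛ (w i) W₀ z) hlm
      calc _ ≤ _ := this
        _ = _ := by ring)
    (fun i j z => by
      have e1 : f i z - f j z =
          l / m * (ℓ (tensorInner (w i) z.1) z.2 - ℓ (tensorInner (w j) z.1) z.2) := by
        simp only [hf]; ring
      have e2 : t i z - t j z = l / m * Λ * (tensorInner (w i) z.1 - tensorInner (w j) z.1) := by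
        simp only [ht, tensorInner_sub_left]; ring
      rw [e1, e2, abs_mul, abs_mul, abs_mul, abs_of_nonneg hlm, NNReal.abs_eq, mul_assoc]
      exact mul_le_mul_of_nonneg_left (abs_loss_sub_le hΛ (w i) (w j) z) hlm)
    hsymm m 0
  have hlin := lintegral_exp_iSup_tensorInner_le hμ hw hW₀ k m
    (τ := l * Λ / m) (by positivity)
  simp only [Pi.zero_apply, zero_add] at hmain
  refine le_trans (le_of_eq ?_) ((hmain.trans hlin).trans (le_of_eq ?_))
  · refine lintegral_congr fun S => ?_
    rw [Real.mul_iSup_of_nonneg hl]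
    congr 3
    funext i
    have e1 : ∫ z', f i z' ∂μ = l / m * (risk ℓ μ (w i) - risk ℓ μ W₀) := by
      rw [hf]
      simp only
      rw [integral_const_mul, integral_sub (integrable_loss hℓ hΛ hμ h0 _)
        (integrable_loss hℓ hΛ hμ h0 _)]
      rfl
    rw [Finset.sum_sub_distrib, e1]
    simp only [hf, ← Finset.mul_sum, Finset.sum_sub_distrib, excessRiskGap, empiricalRisk,
      Finset.sum_const, Finset.card_univ, Fintype.card_fin, nsmul_eq_mul]
    field_simp
  · congr 2
    field_simp
    ring

lemma abs_excessRiskGap_update_sub_le {M : ℝ} (hM : ∀ t y, 0 ≤ ℓ t y ∧ ℓ t y ≤ M)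
    (W₀ W : Tensor n) {m : ℕ} (S : Fin m → Tensor n × 𝒴) (i : Fin m) (z : Tensor n × 𝒴) :
    |excessRiskGap ℓ μ W₀ (Function.update S i z) W - excessRiskGap ℓ μ W₀ S W| ≤ 2 * M / m := by
  have hup : ∀ V : Tensor n, empiricalRisk ℓ (Function.update S i z) V - empiricalRisk ℓ S V =
      1 / m * (ℓ (tensorInner V z.1) z.2 - ℓ (tensorInner V (S i).1) (S i).2) := by
    intro V
    rw [empiricalRisk, empiricalRisk, ← mul_sub, ← Finset.sum_sub_distrib,
      Finset.sum_eq_single i (fun j _ hj => by simp [hj]) (by simp)]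
    simp
  have e : excessRiskGap ℓ μ W₀ (Function.update S i z) W - excessRiskGap ℓ μ W₀ S W =
      (empiricalRisk ℓ (Function.update S i z) W₀ - empiricalRisk ℓ S W₀) -
        (empiricalRisk ℓ (Function.update S i z) W - empiricalRisk ℓ S W) := by
    simp only [excessRiskGap]; ring
  rw [e, hup, hup, ← mul_sub, abs_mul, abs_of_nonneg (by positivity), mul_comm, mul_one_div]
  refine div_le_div_of_nonneg_right (abs_le.2 ?_) (Nat.cast_nonneg m)
  have h1 := hM (tensorInner W₀ z.1) z.2
  have h2 := hM (tensorInner W₀ (S i).1) (S i).2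
  have h3 := hM (tensorInner W z.1) z.2
  have h4 := hM (tensorInner W (S i).1) (S i).2
  constructor <;> linarith

lemma abs_excessRiskGap_le [IsProbabilityMeasure μ] {M : ℝ}
    (hM : ∀ t y, 0 ≤ ℓ t y ∧ ℓ t y ≤ M) (W₀ W : Tensor n) {m : ℕ} (hm : 1 ≤ m)
    (S : Fin m → Tensor n × 𝒴) : |excessRiskGap ℓ μ W₀ S W| ≤ 4 * M := by
  have hm0 : (0 : ℝ) < m := by exact_mod_cast hm
  have habs : ∀ t y, |ℓ t y| ≤ M := fun t y => by rw [abs_of_nonneg (hM t y).1]; exact (hM t y).2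
  have h1 : ∀ V : Tensor n, |risk ℓ μ V| ≤ M := fun V =>
    abs_integral_le_of_forall_abs_le fun z => habs _ _
  have h2 : ∀ V : Tensor n, |empiricalRisk ℓ S V| ≤ M := by
    intro V
    rw [empiricalRisk, abs_mul, abs_of_nonneg (by positivity), one_div, inv_mul_le_iff₀ hm0]
    refine (Finset.abs_sum_le_sum_abs _ _).trans ((Finset.sum_le_sum fun i _ => habs _ _).trans ?_)
    simp
  rw [excessRiskGap, abs_le]
  have a1 := abs_le.1 (h1 W)
  have a2 := abs_le.1 (h1 W₀)
  have a3 := abs_le.1 (h2 W)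
  have a4 := abs_le.1 (h2 W₀)
  constructor <;> linarith

end

/-! ### The excess risk bounds -/

lemma sqrt_add_le_sqrt_add_sqrt {a b : ℝ} (ha : 0 ≤ a) (hb : 0 ≤ b) : √(a + b) ≤ √a + √b := by
  refine Real.sqrt_le_iff.2 ⟨by positivity, ?_⟩
  nlinarith [Real.sq_sqrt ha, Real.sq_sqrt hb, mul_nonneg (Real.sqrt_nonneg a) (Real.sqrt_nonneg b)]

/-- The Chernoff scale for variance proxy `256 * c ^ 2 / m` and entropy `2 * (a + b)`, in the shape
of the leading term of the bound. -/
lemma sqrt_variance_mul_dim_le {a b c : ℝ} {m : ℕ} (ha : 0 ≤ a) (hb : 0 ≤ b) (hc : 0 ≤ c) :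
    √(2 * (256 * c ^ 2 / m) * (2 * (a + b))) ≤ 32 * (c / √(m : ℝ)) * (√a + √b) := by
  have h1 : 2 * (256 * c ^ 2 / m) * (2 * (a + b)) = (32 * (c / √(m : ℝ))) ^ 2 * (a + b) := by
    rw [mul_pow, div_pow, Real.sq_sqrt (Nat.cast_nonneg m)]
    ring
  rw [h1, Real.sqrt_mul (sq_nonneg _), Real.sqrt_sq (by positivity)]
  exact mul_le_mul_of_nonneg_left (sqrt_add_le_sqrt_add_sqrt ha hb) (by positivity)

lemma sqrt_two_mul_sq_div_mul {c L : ℝ} {m : ℕ} (hc : 0 ≤ c) :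
    √(2 * (c ^ 2 / m) * L) = 2 * c * √(L / (2 * m)) := by
  rw [show 2 * (c ^ 2 / m) * L = (2 * c) ^ 2 * (L / (2 * m)) by
    rcases eq_or_ne (m : ℝ) 0 with h | h
    · simp [h]
    · field_simp, Real.sqrt_mul (sq_nonneg _), Real.sqrt_sq (by positivity)]

end

theorem theorem1 :
    ∃ c₁ c₂ : ℝ, 0 < c₁ ∧ 0 < c₂ ∧
      ∀ (K : ℕ) (_ : 1 ≤ K) (n : Fin K → ℕ)
        (𝒴 : Type*) (_ : MeasurableSpace 𝒴)
        (ℓ : ℝ → 𝒴 → ℝ) (_ : Measurable (Function.uncurry ℓ))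
        (Λ : NNReal) (_ : ∀ y, LipschitzWith Λ fun t => ℓ t y)
        (μ : Measure (Tensor n × 𝒴)) (_ : IsProbabilityMeasure μ)
        (_ : μ.map Prod.fst = stdGaussianTensor n)
        (_ : Integrable (fun z => ℓ 0 z.2) μ)
        (m : ℕ) (_ : 1 ≤ m) (δ : ℝ) (_ : 0 < δ) (_ : δ < 1)
        (B B₀ : ℝ) (r : Fin K → ℕ) (W₀ : Tensor n)
        (_ : IsConstrainedMinimizer (risk ℓ μ) B₀ W₀)
        (_ : frobeniusNorm W₀ ≤ B) (_ : ∀ k, modeRank W₀ k = r k)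
        (_ : B₀ ≤ B * ∑ k, √(r k : ℝ)),
        (∀ M : ℝ, (∀ t y, 0 ≤ ℓ t y ∧ ℓ t y ≤ M) →
          ExcessRiskAtMost ℓ μ m B₀ W₀
            (c₁ * Λ * (B / √(m : ℝ)) * (∑ k, √(r k : ℝ)) *
                (⨅ k : Fin K, (√(n k : ℝ) + √(coDim n k : ℝ))) +
              c₂ * M * √(Real.log (2 / δ) / (2 * m))) δ) ∧
        ExcessRiskAtMost ℓ μ m B₀ W₀
          (c₁ * Λ * (B / √(m : ℝ)) * (∑ k, √(r k : ℝ)) *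
              (⨅ k : Fin K, (√(n k : ℝ) + √(coDim n k : ℝ))) +
            c₂ * (Λ * B₀) * √(Real.log (2 / δ) / (2 * m))) δ := by
  refine ⟨32, 32, by norm_num, by norm_num, ?_⟩
  intro K hK n 𝒴 _ ℓ hℓ Λ hΛ μ _ hμ h0 m hm δ hδ hδ1 B B₀ r W₀ hmin _ _ hB
  have hW₀ : overlapNorm W₀ ≤ B₀ := hmin.1
  have hB₀ : 0 ≤ B₀ := (overlapNorm_nonneg _).trans hW₀
  have hΛB : 0 ≤ Λ * B₀ := mul_nonneg Λ.coe_nonneg hB₀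
  have : Nonempty (Fin K) := ⟨⟨0, hK⟩⟩
  obtain ⟨k, hk⟩ := exists_eq_ciInf_of_finite (f := fun k : Fin K => √(n k : ℝ) + √(coDim n k : ℝ))
  rw [← hk]
  set V : ℝ := 256 * (Λ * B₀) ^ 2 / m with hV
  set D : ℝ := 2 * (n k + coDim n k) with hD
  have hV0 : 0 ≤ V := by positivity
  have hD0 : 0 ≤ D := by positivity
  have hmgf : ∀ (N : ℕ) (w : Fin (N + 1) → Tensor n), (∀ i, overlapNorm (w i) ≤ B₀) →
      ∀ l, 0 ≤ l → ∫⁻ S, ENNReal.ofReal (Real.exp (l * ⨆ i, excessRiskGap ℓ μ W₀ S (w i)))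
        ∂(Measure.pi fun _ : Fin m => μ) ≤ ENNReal.ofReal (Real.exp (D + V * l ^ 2 / 2)) :=
    fun N w hw l hl => lintegral_exp_iSup_excessRiskGap_le hℓ hΛ hμ h0 hw hW₀ k hm hl
  have hlead : √(2 * V * D) ≤ 32 * Λ * (B / √(m : ℝ)) * (∑ k, √(r k : ℝ)) *
      (√(n k : ℝ) + √(coDim n k : ℝ)) := by
    refine (sqrt_variance_mul_dim_le (Nat.cast_nonneg _) (Nat.cast_nonneg _) hΛB).trans ?_
    refine mul_le_mul_of_nonneg_right ?_ (by positivity)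
    have := mul_le_mul_of_nonneg_left hB (by positivity : 0 ≤ 32 * (Λ : ℝ) / √(m : ℝ))
    calc _ = 32 * (Λ : ℝ) / √(m : ℝ) * B₀ := by ring
      _ ≤ _ := this
      _ = _ := by ring
  set L : ℝ := Real.log (1 / δ) with hL
  have hL0 : 0 ≤ L := Real.log_nonneg (by rw [le_div_iff₀ hδ]; linarith)
  have hLδ : Real.exp (-L) = δ := by
    rw [hL, one_div, Real.log_inv, neg_neg, Real.exp_log hδ]
  have hL2 : √(L / (2 * m)) ≤ √(Real.log (2 / δ) / (2 * m)) := by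
    refine Real.sqrt_le_sqrt (div_le_div_of_nonneg_right (Real.log_le_log (by positivity) ?_)
      (by positivity))
    exact div_le_div_of_nonneg_right (by norm_num) hδ.le
  constructor
  · intro M hM
    obtain ⟨z₀⟩ : Nonempty (Tensor n × 𝒴) := nonempty_of_isProbabilityMeasure μ
    have hM0 : 0 ≤ M := (hM 0 z₀.2).1.trans (hM 0 z₀.2).2
    refine excessRiskAtMost_of_finite_families hℓ hΛ hμ h0 hW₀ fun N w hw s hs => ?_
    set Z : (Fin m → Tensor n × 𝒴) → ℝ := fun S => ⨆ i, excessRiskGap ℓ μ W₀ S (w i) with hZ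
    have hZm : Measurable Z := measurable_iSup_excessRiskGap hℓ W₀ w
    have hZb : ∀ S, |Z S| ≤ 4 * M := by
      intro S
      obtain ⟨i, hi⟩ := exists_eq_ciSup_of_finite (f := fun i => excessRiskGap ℓ μ W₀ S (w i))
      rw [hZ]
      simp only
      rw [← hi]
      exact abs_excessRiskGap_le hM W₀ (w i) hm S
    have hmean := integral_le_of_lintegral_exp_le (Integrable.of_bound hZm.aestronglyMeasurable
      (4 * M) (ae_of_all _ hZb)) hV0 (hmgf N w hw)
    have hm0 : (m : ℝ) ≠ 0 := by positivity
    have hmcd := lintegral_exp_sub_integral_le_of_bounded_differences (μ := μ) hZm hZb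
      (c := 2 * M / m) fun S i z => abs_iSup_sub_iSup_le fun j =>
        abs_excessRiskGap_update_sub_le hM W₀ (w j) S i z
    -- Bounded differences control the deviation from the mean, and the mean is controlled by the
    -- moment generating function; the variance proxy `V` enters only through the mean.
    have htail := measure_le_of_lintegral_exp_le (hZm.sub_const _) (D := 0) (V := M ^ 2 / m)
      le_rfl hL0 (fun l _ => (hmcd l).trans (le_of_eq (by
        congr 2
        field_simp
        ring))) (s := s - ∫ S, Z S ∂(Measure.pi fun _ : Fin m => μ)) (by
        rw [zero_add, sqrt_two_mul_sq_div_mul hM0]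
        nlinarith [mul_nonneg hM0 (Real.sqrt_nonneg (L / (2 * m))),
          mul_le_mul_of_nonneg_left hL2 hM0])
    rw [hLδ] at htail
    simpa only [sub_le_sub_iff_right] using htail
  · refine excessRiskAtMost_of_finite_families hℓ hΛ hμ h0 hW₀ fun N w hw s hs => ?_
    have htail := measure_le_of_lintegral_exp_le (measurable_iSup_excessRiskGap hℓ W₀ w) hD0 hL0
      (hmgf N w hw) (s := s) (by
        have h1 : √(2 * V * (D + L)) ≤ √(2 * V * D) + √(2 * V * L) := by
          rw [mul_add]
          exact sqrt_add_le_sqrt_add_sqrt (by positivity) (by positivity)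
        have h2 : √(2 * V * L) = 2 * (16 * (Λ * B₀)) * √(L / (2 * m)) := by
          rw [← sqrt_two_mul_sq_div_mul (by positivity), hV]
          ring_nf
        have h3 := mul_le_mul_of_nonneg_left hL2 hΛB
        linarith)
    rwa [hLδ] at htail
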